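/- Let $d\ge 1$, let $\mathscr E=\{E_i\}_{i=1}^m$ and $\mathscr G=\{G_j\}_{j=1}^n$ be POVMs on $\mathbb C^d$ (positive semidefinite matrices summing to the identity), and let $p\in[0,1]$. Let $\widehat{\mathscr E}=\{\widehat E_i\}_{i=1}^{m+n}$ be the mixed POVM with $\widehat E_i=pE_i$ for $1\le i\le m$ and $\widehat E_i=(1-p)G_{i-m}$ for $m<i\le m+n$. For a POVM $\mathscr E=\{E_k\}$ and density matrices $\rho,\sigma$ on $\mathbb C^d$ write $P_k=\mathrm{tr}(\rho E_k)$, $\overline P_k=\mathrm{tr}(\sigma E_k)$, $\phi(s|P\|\overline P)=\log\sum_k P_k^s\overline P_k^{\,1-s}$ and $D(P\|\overline P)=\sum_k P_k\log(P_k/\overline P_k)$ (with the usual conventions $\log 0=-\infty$, $0\log(0/x)=0$, and $D(P\|\overline P)=+\infty$ if $P_k>0=\overline P_k$ for some $k$). Define $$C_{\mathscr E}=\inf_{(\rho,\sigma)}\inf_{0\le s\le 1}\sum_k P_k^s\overline P_k^{\,1-s},\qquad \zeta_{\rm CB}^{\mathscr E}=-\inf_{(\rho,\sigma)}\inf_{0\le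 s\le1}\phi(s|P\|\overline P),$$ $$\zeta_{\rm SL}^{\mathscr E}=\sup_{(\rho,\sigma)}D(P\|\overline P),\qquad \zeta_{\rm HB}^{\mathscr E}(r)=\sup_{(\rho,\sigma)}\ \sup_{0\le s<1}\frac{-sr-\phi(s|P\|\overline P)}{1-s}\quad(r\ge 0),$$ where the exponents $\zeta$ take values in $[0,+\infty]$ and $0\cdot\infty=0$. Then, for every $r\ge0$, 1. $\zeta_{\rm CB}^{\widehat{\mathscr E}}\le p\,\zeta_{\rm CB}^{\mathscr E}+(1-p)\,\zeta_{\rm CB}^{\mathscr G}$; 2. $\zeta_{\rm CB}^{\widehat{\mathscr E}}\ge-\log\min\{p\,C_{\mathscr E}+(1-p),\ p+(1-p)\,C_{\mathscr G}\}$; 3. $\zeta_{\rm SL}^{\widehat{\mathscr E}}\le p\,\zeta_{\rm SL}^{\mathscr E}+(1-p)\,\zeta_{\rm SL}^{\mathscr G}$; 4. $\zeta_{\rm SL}^{\widehat{\mathscr E}}\ge\max\{p\,\zeta_{\rm SL}^{\mathscr E},\ (1-p)\,\zeta_{\rm SL}^{\mathscr G}\}$; 5. $\zeta_{\rm HB}^{\widehat{\mathscr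 E}}(r)\le p\,\zeta_{\rm HB}^{\mathscr E}(r)+(1-p)\,\zeta_{\rm HB}^{\mathscr G}(r)$. In particular, mixing never increases the discrimination power beyond that of the better POVM: $\zeta_{\rm CB}^{\widehat{\mathscr E}}\le\max\{\zeta_{\rm CB}^{\mathscr E},\zeta_{\rm CB}^{\mathscr G}\}$, $\zeta_{\rm SL}^{\widehat{\mathscr E}}\le\max\{\zeta_{\rm SL}^{\mathscr E},\zeta_{\rm SL}^{\mathscr G}\}$ and $\zeta_{\rm HB}^{\widehat{\mathscr E}}(r)\le\max\{\zeta_{\rm HB}^{\mathscr E}(r),\zeta_{\rm HB}^{\mathscr G}(r)\}$. -/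

import Mathlib

namespace Discrimination

noncomputable section

open scoped ComplexOrder

/-- Density matrices (states) on the `d`-dimensional Hilbert space `ℂ^d`. -/
structure DensityMatrix (d : ℕ) where
  mat : Matrix (Fin d) (Fin d) ℂ
  posSemidef : mat.PosSemidef
  trace_eq_one : mat.trace = 1

/-- Positive operator valued measures with `m` outcomes on `ℂ^d`. -/
structure POVM (d m : ℕ) where
  effect : Fin m → Matrix (Fin d) (Fin d) ℂ
  posSemidef : ∀ k, (effect k).PosSemidef
  sum_eq_one : ∑ k, effect k = 1

/-- The mixed POVM: its first `m` elements are `p • E i`, its last `n` elements are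
`(1 - p) • G j`. -/
def POVM.mix {d m n : ℕ} (p : ℝ) (hp : p ∈ Set.Icc (0 : ℝ) 1) (E : POVM d m) (G : POVM d n) :
    POVM d (m + n) where
  effect := Fin.append (fun i => (p : ℂ) • E.effect i) (fun j => ((1 - p : ℝ) : ℂ) • G.effect j)
  posSemidef := by
    have h0 : (0 : ℂ) ≤ (p : ℂ) := by exact_mod_cast hp.1
    have h1 : (0 : ℂ) ≤ ((1 - p : ℝ) : ℂ) := by exact_mod_cast sub_nonneg.2 hp.2
    intro k
    refine Fin.addCases (fun i => ?_) (fun j => ?_) k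
    · rw [Fin.append_left]
      exact (E.posSemidef i).smul h0
    · rw [Fin.append_right]
      exact (G.posSemidef j).smul h1
  sum_eq_one := by
    rw [Fin.sum_univ_add]
    simp only [Fin.append_left, Fin.append_right]
    rw [← Finset.smul_sum, ← Finset.smul_sum, E.sum_eq_one, G.sum_eq_one, ← add_smul]
    simp

/-- Outcome distribution `P_k = tr (ρ E_k)` (a nonnegative real number). -/
def POVM.prob {d m : ℕ} (E : POVM d m) (ρ : DensityMatrix d) (k : Fin m) : ℝ :=
  (Matrix.trace (ρ.mat * E.effect k)).re

/-- `∑ k, P_k ^ s * Q_k ^ (1 - s)`. -/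
def overlap {m : ℕ} (s : ℝ) (P Q : Fin m → ℝ) : ℝ :=
  ∑ k, P k ^ s * Q k ^ (1 - s)

/-- Logarithm of a nonnegative real number, with `log 0 = -∞`. -/
def elog (x : ℝ) : EReal := ENNReal.log (ENNReal.ofReal x)

/-- `φ(s | P ‖ Q) = log ∑ k, P_k ^ s * Q_k ^ (1 - s)`. -/
def phi {m : ℕ} (s : ℝ) (P Q : Fin m → ℝ) : EReal := elog (overlap s P Q)

open Classical in
/-- Relative entropy `D(P ‖ Q) = ∑ k, P_k log (P_k / Q_k)`, which is `+∞` unless the support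
of `P` is contained in that of `Q`; terms with `P_k = 0` are `0`. -/
def relEntropy {m : ℕ} (P Q : Fin m → ℝ) : EReal :=
  if ∀ k, Q k = 0 → P k = 0 then ((∑ k, P k * Real.log (P k / Q k) : ℝ) : EReal) else ⊤

/-- `C_E`, the infimum over state pairs and `s ∈ [0, 1]` of
`∑ k, (tr ρ E_k) ^ s * (tr σ E_k) ^ (1 - s)`. -/
def POVM.C {d m : ℕ} (E : POVM d m) : ℝ :=
  ⨅ (ρ : DensityMatrix d) (σ : DensityMatrix d) (s : Set.Icc (0 : ℝ) 1),
    overlap s (E.prob ρ) (E.prob σ)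

/-- Chernoff exponent of a POVM. -/
def POVM.zetaCB {d m : ℕ} (E : POVM d m) : EReal :=
  -⨅ (ρ : DensityMatrix d) (σ : DensityMatrix d) (s ∈ Set.Icc (0 : ℝ) 1),
    phi s (E.prob ρ) (E.prob σ)

/-- Stein exponent of a POVM. -/
def POVM.zetaSL {d m : ℕ} (E : POVM d m) : EReal :=
  ⨆ (ρ : DensityMatrix d) (σ : DensityMatrix d), relEntropy (E.prob ρ) (E.prob σ)

/-- Hoeffding exponent of a POVM at rate `r`. The expression is `0 / 0` or infinite at `s = 1`, so
the supremum is over `0 ≤ s < 1`; this includes the limit `s → 1`. -/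
def POVM.zetaHB {d m : ℕ} (r : ℝ) (E : POVM d m) : EReal :=
  ⨆ (ρ : DensityMatrix d) (σ : DensityMatrix d) (s ∈ Set.Ico (0 : ℝ) 1),
    (((-(s * r) : ℝ) : EReal) - phi s (E.prob ρ) (E.prob σ)) / ((1 - s : ℝ) : EReal)

end

end Discrimination

namespace Discrimination

open scoped ComplexOrder

/-! Fix `ρ`, `σ`, `s`. Mixing rescales the outcome probabilities of both states by the same weight,
and the exponents `s` and `1 - s` sum to 1, so the overlap of the mixture is the convex combination
of the two overlaps (`POVM.overlap_mix`). Convexity of `-log` then gives the Chernoff and Hoeffding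
upper bounds before suprema are taken. In the relative entropy the weight cancels inside the
logarithm, so it is exactly affine under mixing (`POVM.relEntropy_mix`); this gives the Stein upper
bound, and dropping a nonnegative term gives the lower one. The Chernoff lower bound comes from
replacing one of the overlaps by 1, a bound due to weighted AM-GM. The remaining care concerns
infinite values. -/

theorem elog_of_pos {x : ℝ} (hx : 0 < x) : elog x = (Real.log x : EReal) :=
  ENNReal.log_ofReal_of_pos hx

theorem elog_zero : elog 0 = ⊥ := by simp [elog]

theorem elog_nonpos {x : ℝ} (h : x ≤ 1) : elog x ≤ 0 := by
  rw [elog, ENNReal.log_le_zero_iff]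
  simpa using h

/-- Convexity of `-log` in the form common to both exponents: `c = 0`, `t = 1` for Chernoff, `c =
-(s * r)`, `t = 1 - s` for Hoeffding. -/
theorem affine_elog_convex {c t p a b : ℝ} (ht : 0 < t) (hp : p ∈ Set.Icc (0 : ℝ) 1)
    (ha : 0 ≤ a) (hb : 0 ≤ b) :
    ((c : EReal) - elog (p * a + (1 - p) * b)) / (t : EReal)
      ≤ (p : EReal) * (((c : EReal) - elog a) / (t : EReal))
        + ((1 - p : ℝ) : EReal) * (((c : EReal) - elog b) / (t : EReal)) := by
  -- `⊥ + ⊤ = ⊥` in `EReal`, so a `⊤` summand absorbs the other only once that one is known not to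
  -- be `⊥`.
  have ne_bot : ∀ (q x : ℝ), 0 ≤ q →
      (q : EReal) * (((c : EReal) - elog x) / (t : EReal)) ≠ ⊥ := by
    intro q x hq
    rcases le_or_gt x 0 with hx | hx
    · have h : elog x = ⊥ := by simpa [elog] using hx
      rw [h, EReal.coe_sub_bot,
        EReal.top_div_of_pos_ne_top (EReal.coe_pos.2 ht) (EReal.coe_ne_top t)]
      rcases hq.eq_or_lt with rfl | hq
      · simp
      · rw [EReal.coe_mul_top_of_pos hq]; simp
    · rw [elog_of_pos hx]
      exact_mod_cast EReal.coe_ne_bot (q * ((c - Real.log x) / t))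
  have top : ∀ q : ℝ, 0 < q → (q : EReal) * (((c : EReal) - elog 0) / (t : EReal)) = ⊤ := by
    intro q hq
    rw [elog_zero, EReal.coe_sub_bot,
      EReal.top_div_of_pos_ne_top (EReal.coe_pos.2 ht) (EReal.coe_ne_top t),
      EReal.coe_mul_top_of_pos hq]
  rcases hp.1.eq_or_lt with rfl | hp0
  · simp
  rcases hp.2.eq_or_lt with rfl | hp1
  · simp
  have hq : 0 < 1 - p := sub_pos.2 hp1
  rcases ha.eq_or_lt with rfl | ha
  · rw [top p hp0, EReal.top_add_of_ne_bot (ne_bot _ _ hq.le)]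
    exact le_top
  rcases hb.eq_or_lt with rfl | hb
  · rw [top _ hq, EReal.add_top_of_ne_bot (ne_bot _ _ hp0.le)]
    exact le_top
  rw [elog_of_pos ha, elog_of_pos hb, elog_of_pos (by positivity)]
  have h := strictConcaveOn_log_Ioi.concaveOn.2 (Set.mem_Ioi.2 ha) (Set.mem_Ioi.2 hb) hp0.le hq.le
    (by ring)
  simp only [smul_eq_mul] at h
  have : (c - Real.log (p * a + (1 - p) * b)) / t
      ≤ p * ((c - Real.log a) / t) + (1 - p) * ((c - Real.log b) / t) := by
    rw [← mul_div_assoc, ← mul_div_assoc, ← add_div]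
    gcongr
    linarith
  simp only [← EReal.coe_sub, ← EReal.coe_div, ← EReal.coe_mul, ← EReal.coe_add]
  exact EReal.coe_le_coe_iff.2 this

theorem _root_.Matrix.PosSemidef.trace_mul_nonneg {d : ℕ} {A B : Matrix (Fin d) (Fin d) ℂ}
    (hA : A.PosSemidef) (hB : B.PosSemidef) : 0 ≤ (A * B).trace := by
  obtain ⟨C, rfl⟩ : ∃ C : Matrix (Fin d) (Fin d) ℂ, A = C.conjTranspose * C := by
    open scoped MatrixOrder in
    exact CStarAlgebra.nonneg_iff_eq_star_mul_self.1 hA.nonneg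
  rw [Matrix.mul_assoc, Matrix.trace_mul_comm]
  exact (hB.mul_mul_conjTranspose_same C).trace_nonneg

theorem DensityMatrix.nonempty {d : ℕ} (hd : 1 ≤ d) : Nonempty (DensityMatrix d) := by
  refine ⟨⟨Matrix.diagonal (Pi.single ⟨0, hd⟩ 1), ?_, ?_⟩⟩
  · rw [Matrix.posSemidef_diagonal_iff]
    intro i
    by_cases h : i = ⟨0, hd⟩ <;> simp [h]
  · simp [Matrix.trace_diagonal]

variable {d m n : ℕ}

/-! ### Outcome distributions and overlaps -/

theorem POVM.prob_nonneg (E : POVM d m) (ρ : DensityMatrix d) (k : Fin m) : 0 ≤ E.prob ρ k :=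
  (Complex.nonneg_iff.1 (ρ.posSemidef.trace_mul_nonneg (E.posSemidef k))).1

theorem POVM.sum_prob (E : POVM d m) (ρ : DensityMatrix d) : ∑ k, E.prob ρ k = 1 := by
  simp only [POVM.prob]
  rw [← Complex.re_sum, ← Matrix.trace_sum, ← Matrix.mul_sum, E.sum_eq_one, Matrix.mul_one,
    ρ.trace_eq_one, Complex.one_re]

theorem POVM.mix_prob_castAdd {p : ℝ} (hp : p ∈ Set.Icc (0 : ℝ) 1) (E : POVM d m) (G : POVM d n)
    (ρ : DensityMatrix d) (k : Fin m) :
    (POVM.mix p hp E G).prob ρ (Fin.castAdd n k) = p * E.prob ρ k := by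
  simp [POVM.prob, POVM.mix]

theorem POVM.mix_prob_natAdd {p : ℝ} (hp : p ∈ Set.Icc (0 : ℝ) 1) (E : POVM d m) (G : POVM d n)
    (ρ : DensityMatrix d) (k : Fin n) :
    (POVM.mix p hp E G).prob ρ (Fin.natAdd m k) = (1 - p) * G.prob ρ k := by
  simp only [POVM.prob, POVM.mix, Fin.append_right, Matrix.mul_smul, Matrix.trace_smul, smul_eq_mul,
    Complex.re_ofReal_mul]

theorem overlap_nonneg {s : ℝ} {P Q : Fin m → ℝ} (hP : ∀ k, 0 ≤ P k) (hQ : ∀ k, 0 ≤ Q k) :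
    0 ≤ overlap s P Q :=
  Finset.sum_nonneg fun k _ => mul_nonneg (Real.rpow_nonneg (hP k) _) (Real.rpow_nonneg (hQ k) _)

theorem overlap_le_one {s : ℝ} {P Q : Fin m → ℝ} (hs : s ∈ Set.Icc (0 : ℝ) 1)
    (hP : ∀ k, 0 ≤ P k) (hQ : ∀ k, 0 ≤ Q k) (hP1 : ∑ k, P k = 1) (hQ1 : ∑ k, Q k = 1) :
    overlap s P Q ≤ 1 := by
  calc overlap s P Q ≤ ∑ k, (s * P k + (1 - s) * Q k) := Finset.sum_le_sum fun k _ =>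
        Real.geom_mean_le_arith_mean2_weighted hs.1 (sub_nonneg.2 hs.2) (hP k) (hQ k) (by ring)
    _ = 1 := by rw [Finset.sum_add_distrib, ← Finset.mul_sum, ← Finset.mul_sum, hP1, hQ1]; ring

theorem mul_rpow_mul_rpow_one_sub {q x y : ℝ} (s : ℝ) (hq : 0 ≤ q) (hx : 0 ≤ x) (hy : 0 ≤ y) :
    (q * x) ^ s * (q * y) ^ (1 - s) = q * (x ^ s * y ^ (1 - s)) := by
  have h : q ^ s * q ^ (1 - s) = q := by
    -- Only the total exponent 1 has to be nonzero, so `q = 0` needs no separate case.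
    rw [← Real.rpow_add' hq (by simp), add_sub_cancel, Real.rpow_one]
  rw [Real.mul_rpow hq hx, Real.mul_rpow hq hy, mul_mul_mul_comm, h]

theorem POVM.overlap_mix {p : ℝ} (hp : p ∈ Set.Icc (0 : ℝ) 1) (E : POVM d m) (G : POVM d n)
    (ρ σ : DensityMatrix d) (s : ℝ) :
    overlap s ((POVM.mix p hp E G).prob ρ) ((POVM.mix p hp E G).prob σ)
      = p * overlap s (E.prob ρ) (E.prob σ) + (1 - p) * overlap s (G.prob ρ) (G.prob σ) := by
  simp only [overlap, Fin.sum_univ_add, POVM.mix_prob_castAdd, POVM.mix_prob_natAdd,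
    Finset.mul_sum, mul_rpow_mul_rpow_one_sub s hp.1 (E.prob_nonneg ρ _) (E.prob_nonneg σ _),
    mul_rpow_mul_rpow_one_sub s (sub_nonneg.2 hp.2) (G.prob_nonneg ρ _) (G.prob_nonneg σ _)]

theorem POVM.overlap_nonneg (E : POVM d m) (ρ σ : DensityMatrix d) (s : ℝ) :
    0 ≤ overlap s (E.prob ρ) (E.prob σ) :=
  Discrimination.overlap_nonneg (E.prob_nonneg ρ) (E.prob_nonneg σ)

theorem POVM.overlap_le_one (E : POVM d m) (ρ σ : DensityMatrix d) {s : ℝ}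
    (hs : s ∈ Set.Icc (0 : ℝ) 1) : overlap s (E.prob ρ) (E.prob σ) ≤ 1 :=
  Discrimination.overlap_le_one hs (E.prob_nonneg ρ) (E.prob_nonneg σ) (E.sum_prob ρ)
    (E.sum_prob σ)

/-! ### Chernoff exponent -/

theorem POVM.neg_phi_le_zetaCB (E : POVM d m) (ρ σ : DensityMatrix d) {s : ℝ}
    (hs : s ∈ Set.Icc (0 : ℝ) 1) : -phi s (E.prob ρ) (E.prob σ) ≤ E.zetaCB :=
  EReal.neg_le_neg_iff.2 (iInf_le_of_le ρ (iInf_le_of_le σ (iInf₂_le s hs)))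

theorem POVM.zetaCB_le (E : POVM d m) {x : EReal}
    (h : ∀ ρ σ : DensityMatrix d, ∀ s ∈ Set.Icc (0 : ℝ) 1, -phi s (E.prob ρ) (E.prob σ) ≤ x) :
    E.zetaCB ≤ x :=
  EReal.neg_le_of_neg_le (le_iInf fun ρ => le_iInf fun σ => le_iInf₂ fun s hs =>
    EReal.neg_le_of_neg_le (h ρ σ s hs))

theorem POVM.zetaCB_nonneg (hd : 1 ≤ d) (E : POVM d m) : 0 ≤ E.zetaCB := by
  obtain ⟨ρ⟩ := DensityMatrix.nonempty hd
  have hs : (0 : ℝ) ∈ Set.Icc (0 : ℝ) 1 := by simp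
  refine le_trans ?_ (E.neg_phi_le_zetaCB ρ ρ hs)
  exact EReal.neg_nonneg.2 (elog_nonpos (E.overlap_le_one ρ ρ hs))

theorem ereal_convex_add_mono {p : ℝ} (hp : p ∈ Set.Icc (0 : ℝ) 1) {x y x' y' : EReal}
    (hx : x ≤ x') (hy : y ≤ y') :
    (p : EReal) * x + ((1 - p : ℝ) : EReal) * y ≤ (p : EReal) * x' + ((1 - p : ℝ) : EReal) * y' :=
  add_le_add (mul_le_mul_of_nonneg_left hx (EReal.coe_nonneg.2 hp.1))
    (mul_le_mul_of_nonneg_left hy (EReal.coe_nonneg.2 (sub_nonneg.2 hp.2)))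

theorem ereal_convex_add_le_max {p : ℝ} (hp : p ∈ Set.Icc (0 : ℝ) 1) (x y : EReal) :
    (p : EReal) * x + ((1 - p : ℝ) : EReal) * y ≤ max x y := by
  refine (ereal_convex_add_mono hp (le_max_left x y) (le_max_right x y)).trans_eq ?_
  rw [← EReal.right_distrib_of_nonneg (EReal.coe_nonneg.2 hp.1)
    (EReal.coe_nonneg.2 (sub_nonneg.2 hp.2)), ← EReal.coe_add, add_sub_cancel, EReal.coe_one,
    one_mul]

theorem POVM.zetaCB_mix_le {p : ℝ} (hp : p ∈ Set.Icc (0 : ℝ) 1) (E : POVM d m) (G : POVM d n) :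
    (POVM.mix p hp E G).zetaCB
      ≤ (p : EReal) * E.zetaCB + ((1 - p : ℝ) : EReal) * G.zetaCB := by
  refine POVM.zetaCB_le _ fun ρ σ s hs => ?_
  refine le_trans ?_ (ereal_convex_add_mono hp (E.neg_phi_le_zetaCB ρ σ hs)
    (G.neg_phi_le_zetaCB ρ σ hs))
  have h := affine_elog_convex (c := 0) one_pos hp (E.overlap_nonneg ρ σ s) (G.overlap_nonneg ρ σ s)
  simpa [phi, POVM.overlap_mix] using h

theorem POVM.le_affine_C (hd : 1 ≤ d) (E : POVM d m) {p y : ℝ} (hp : p ∈ Set.Icc (0 : ℝ) 1)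
    (h : ∀ ρ σ : DensityMatrix d, ∀ s ∈ Set.Icc (0 : ℝ) 1,
      y ≤ p * overlap s (E.prob ρ) (E.prob σ) + (1 - p)) :
    y ≤ p * E.C + (1 - p) := by
  have := DensityMatrix.nonempty hd
  -- Division by `p` moves the bound inside the infimum; for `p = 0` any single state already gives
  -- `y ≤ 1`.
  rcases hp.1.eq_or_lt with rfl | hp0
  · obtain ⟨ρ⟩ := this
    simpa using h ρ ρ 0 (by simp)
  · have : (y - (1 - p)) / p ≤ E.C :=
      le_ciInf fun ρ => le_ciInf fun σ => le_ciInf fun s => by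
        rw [div_le_iff₀' hp0]
        linarith [h ρ σ s s.2]
    rw [div_le_iff₀' hp0] at this
    linarith

theorem POVM.neg_elog_min_le_zetaCB_mix (hd : 1 ≤ d) {p : ℝ} (hp : p ∈ Set.Icc (0 : ℝ) 1)
    (E : POVM d m) (G : POVM d n) :
    -elog (min (p * E.C + (1 - p)) (p + (1 - p) * G.C)) ≤ (POVM.mix p hp E G).zetaCB := by
  have hq := sub_nonneg.2 hp.2
  -- `z = exp (-zetaCB)` bounds every mixed overlap from below; `zetaCB ≥ 0` makes it finite, so the
  -- comparison takes place in the reals.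
  obtain ⟨z, hz⟩ := ENNReal.log_surjective (-(POVM.mix p hp E G).zetaCB)
  have hz1 : z ≤ 1 := by
    rw [← ENNReal.log_le_zero_iff, hz]
    simpa using POVM.zetaCB_nonneg hd (POVM.mix p hp E G)
  have hzt : z ≠ ⊤ := ne_top_of_le_ne_top ENNReal.one_ne_top hz1
  lift z to NNReal using hzt
  have key : ∀ ρ σ : DensityMatrix d, ∀ s ∈ Set.Icc (0 : ℝ) 1,
      (z : ℝ) ≤ p * overlap s (E.prob ρ) (E.prob σ)
        + (1 - p) * overlap s (G.prob ρ) (G.prob σ) := by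
    intro ρ σ s hs
    have h := EReal.neg_le_of_neg_le ((POVM.mix p hp E G).neg_phi_le_zetaCB ρ σ hs)
    rw [← hz, phi, elog, ENNReal.log_le_log_iff, POVM.overlap_mix] at h
    rwa [← ENNReal.ofReal_coe_nnreal, ENNReal.ofReal_le_ofReal_iff] at h
    exact add_nonneg (mul_nonneg hp.1 (E.overlap_nonneg ρ σ s))
      (mul_nonneg hq (G.overlap_nonneg ρ σ s))
  have hmin : (z : ℝ) ≤ min (p * E.C + (1 - p)) (p + (1 - p) * G.C) := by
    refine le_min (E.le_affine_C hd hp fun ρ σ s hs => ?_) ?_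
    · have := mul_le_mul_of_nonneg_left (G.overlap_le_one ρ σ hs) hq
      linarith [key ρ σ s hs]
    · have := G.le_affine_C hd (p := 1 - p) (y := z) ⟨hq, by linarith [hp.1]⟩ fun ρ σ s hs => by
        have := mul_le_mul_of_nonneg_left (E.overlap_le_one ρ σ hs) hp.1
        linarith [key ρ σ s hs]
      linarith
  refine EReal.neg_le_of_neg_le ?_
  rw [← hz, elog, ENNReal.log_le_log_iff, ← ENNReal.ofReal_coe_nnreal]
  exact ENNReal.ofReal_le_ofReal hmin

/-! ### Relative entropy and Stein exponent -/

theorem relEntropy_nonneg {P Q : Fin m → ℝ} (hP : ∀ k, 0 ≤ P k) (hQ : ∀ k, 0 ≤ Q k)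
    (hPQ : ∑ k, Q k ≤ ∑ k, P k) : 0 ≤ relEntropy P Q := by
  unfold relEntropy
  split_ifs with h
  -- Termwise, from `log x ≥ 1 - 1/x` at `x = P k / Q k`.
  · have : ∑ k, (P k - Q k) ≤ ∑ k, P k * Real.log (P k / Q k) := by
      refine Finset.sum_le_sum fun k _ => ?_
      rcases (hP k).eq_or_lt with h0 | h0
      · simp [← h0, hQ k]
      · have hQ0 : 0 < Q k := (hQ k).lt_of_ne fun h1 => h0.ne' (h k h1.symm)
        have h1 := Real.one_sub_inv_le_log_of_pos (div_pos h0 hQ0)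
        have h2 := mul_le_mul_of_nonneg_left h1 h0.le
        have h3 : P k * (1 - (P k / Q k)⁻¹) = P k - Q k := by field_simp
        linarith
    rw [Finset.sum_sub_distrib] at this
    exact EReal.coe_nonneg.2 (by linarith)
  · exact le_top

theorem POVM.relEntropy_nonneg (E : POVM d m) (ρ σ : DensityMatrix d) :
    0 ≤ relEntropy (E.prob ρ) (E.prob σ) :=
  Discrimination.relEntropy_nonneg (E.prob_nonneg ρ) (E.prob_nonneg σ)
    (by rw [E.sum_prob, E.sum_prob])

/-- A zero weight removes its block from the support condition, matching `0 * ⊤ = 0`. Nonnegativity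
of both entropies excludes `⊤ + ⊥`. -/
theorem relEntropy_append {P Q : Fin m → ℝ} {P' Q' : Fin n → ℝ} {R S : Fin (m + n) → ℝ}
    {a b : ℝ} (ha : 0 ≤ a) (hb : 0 ≤ b)
    (hR : ∀ k, R (Fin.castAdd n k) = a * P k) (hR' : ∀ k, R (Fin.natAdd m k) = b * P' k)
    (hS : ∀ k, S (Fin.castAdd n k) = a * Q k) (hS' : ∀ k, S (Fin.natAdd m k) = b * Q' k)
    (h : 0 ≤ relEntropy P Q) (h' : 0 ≤ relEntropy P' Q') :
    relEntropy R S = (a : EReal) * relEntropy P Q + (b : EReal) * relEntropy P' Q' := by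
  have scale : ∀ {c : ℝ} (x y : ℝ), c * x * Real.log (c * x / (c * y))
      = c * (x * Real.log (x / y)) := by
    intro c x y
    rcases eq_or_ne c 0 with rfl | hc
    · simp
    · rw [mul_div_mul_left _ _ hc, mul_assoc]
  have hsupp : (∀ k, S k = 0 → R k = 0) ↔
      (a = 0 ∨ ∀ k, Q k = 0 → P k = 0) ∧ (b = 0 ∨ ∀ k, Q' k = 0 → P' k = 0) := by
    simp only [Fin.forall_fin_add, hR, hR', hS, hS', mul_eq_zero]
    refine and_congr ?_ ?_
    · by_cases h0 : a = 0 <;> simp [h0]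
    · by_cases h0 : b = 0 <;> simp [h0]
  have hsum : ∑ k, R k * Real.log (R k / S k)
      = a * ∑ k, P k * Real.log (P k / Q k) + b * ∑ k, P' k * Real.log (P' k / Q' k) := by
    simp only [Fin.sum_univ_add, hR, hR', hS, hS', scale, Finset.mul_sum]
  have hnn : 0 ≤ (a : EReal) * relEntropy P Q := mul_nonneg (EReal.coe_nonneg.2 ha) h
  have hnn' : 0 ≤ (b : EReal) * relEntropy P' Q' := mul_nonneg (EReal.coe_nonneg.2 hb) h'
  have term : ∀ {l : ℕ} (c : ℝ) (U V : Fin l → ℝ), (c = 0 ∨ ∀ k, V k = 0 → U k = 0) →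
      (c : EReal) * relEntropy U V = ((c * ∑ k, U k * Real.log (U k / V k) : ℝ) : EReal) := by
    rintro l c U V (rfl | hUV)
    · simp
    · rw [relEntropy, if_pos hUV, EReal.coe_mul]
  have term_top : ∀ {l : ℕ} {c : ℝ} (U V : Fin l → ℝ), 0 ≤ c →
      ¬(c = 0 ∨ ∀ k, V k = 0 → U k = 0) → (c : EReal) * relEntropy U V = ⊤ := by
    intro l c U V hc hUV
    rw [not_or] at hUV
    rw [relEntropy, if_neg hUV.2, EReal.coe_mul_top_of_pos (hc.lt_of_ne' hUV.1)]
  by_cases h1 : a = 0 ∨ ∀ k, Q k = 0 → P k = 0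
  · by_cases h2 : b = 0 ∨ ∀ k, Q' k = 0 → P' k = 0
    · rw [term a P Q h1, term b P' Q' h2, ← EReal.coe_add, ← hsum, relEntropy,
        if_pos (hsupp.2 ⟨h1, h2⟩)]
    · rw [term_top P' Q' hb h2, EReal.add_top_of_ne_bot (ne_bot_of_le_ne_bot EReal.zero_ne_bot hnn),
        relEntropy, if_neg fun hc => h2 (hsupp.1 hc).2]
  · rw [term_top P Q ha h1, EReal.top_add_of_ne_bot (ne_bot_of_le_ne_bot EReal.zero_ne_bot hnn'),
      relEntropy, if_neg fun hc => h1 (hsupp.1 hc).1]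

theorem POVM.relEntropy_mix {p : ℝ} (hp : p ∈ Set.Icc (0 : ℝ) 1) (E : POVM d m) (G : POVM d n)
    (ρ σ : DensityMatrix d) :
    relEntropy ((POVM.mix p hp E G).prob ρ) ((POVM.mix p hp E G).prob σ)
      = (p : EReal) * relEntropy (E.prob ρ) (E.prob σ)
        + ((1 - p : ℝ) : EReal) * relEntropy (G.prob ρ) (G.prob σ) :=
  relEntropy_append hp.1 (sub_nonneg.2 hp.2) (POVM.mix_prob_castAdd hp E G ρ)
    (POVM.mix_prob_natAdd hp E G ρ) (POVM.mix_prob_castAdd hp E G σ)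
    (POVM.mix_prob_natAdd hp E G σ) (E.relEntropy_nonneg ρ σ) (G.relEntropy_nonneg ρ σ)

theorem POVM.relEntropy_le_zetaSL (E : POVM d m) (ρ σ : DensityMatrix d) :
    relEntropy (E.prob ρ) (E.prob σ) ≤ E.zetaSL :=
  le_iSup₂ (f := fun ρ σ : DensityMatrix d => relEntropy (E.prob ρ) (E.prob σ)) ρ σ

theorem POVM.zetaSL_mix_le {p : ℝ} (hp : p ∈ Set.Icc (0 : ℝ) 1) (E : POVM d m) (G : POVM d n) :
    (POVM.mix p hp E G).zetaSL
      ≤ (p : EReal) * E.zetaSL + ((1 - p : ℝ) : EReal) * G.zetaSL :=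
  iSup₂_le fun ρ σ => (POVM.relEntropy_mix hp E G ρ σ).trans_le
    (ereal_convex_add_mono hp (E.relEntropy_le_zetaSL ρ σ) (G.relEntropy_le_zetaSL ρ σ))

theorem POVM.mul_zetaSL_le (hd : 1 ≤ d) (E : POVM d m) {c : ℝ} (hc : 0 ≤ c) {x : EReal}
    (h : ∀ ρ σ : DensityMatrix d, (c : EReal) * relEntropy (E.prob ρ) (E.prob σ) ≤ x) :
    (c : EReal) * E.zetaSL ≤ x := by
  -- A positive finite factor can be divided out past the supremum; for `c = 0` one state is needed
  -- to extract `0 ≤ x`.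
  rcases hc.eq_or_lt with rfl | hc
  · obtain ⟨ρ⟩ := DensityMatrix.nonempty hd
    simpa using h ρ ρ
  · have hc' : (0 : EReal) < c := EReal.coe_pos.2 hc
    rw [mul_comm, ← EReal.le_div_iff_mul_le hc' (EReal.coe_ne_top c)]
    refine iSup₂_le fun ρ σ => ?_
    rw [EReal.le_div_iff_mul_le hc' (EReal.coe_ne_top c), mul_comm]
    exact h ρ σ

theorem POVM.max_le_zetaSL_mix (hd : 1 ≤ d) {p : ℝ} (hp : p ∈ Set.Icc (0 : ℝ) 1)
    (E : POVM d m) (G : POVM d n) :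
    max ((p : EReal) * E.zetaSL) (((1 - p : ℝ) : EReal) * G.zetaSL)
      ≤ (POVM.mix p hp E G).zetaSL := by
  have hq := sub_nonneg.2 hp.2
  refine max_le (E.mul_zetaSL_le hd hp.1 fun ρ σ => ?_) (G.mul_zetaSL_le hd hq fun ρ σ => ?_)
  all_goals
    refine le_trans ?_ ((POVM.mix p hp E G).relEntropy_le_zetaSL ρ σ)
    rw [POVM.relEntropy_mix]
  · exact le_add_of_nonneg_right (mul_nonneg (EReal.coe_nonneg.2 hq) (G.relEntropy_nonneg ρ σ))
  · exact le_add_of_nonneg_left (mul_nonneg (EReal.coe_nonneg.2 hp.1) (E.relEntropy_nonneg ρ σ))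

/-! ### Hoeffding exponent -/

theorem POVM.le_zetaHB (E : POVM d m) (r : ℝ) (ρ σ : DensityMatrix d) {s : ℝ}
    (hs : s ∈ Set.Ico (0 : ℝ) 1) :
    (((-(s * r) : ℝ) : EReal) - phi s (E.prob ρ) (E.prob σ)) / ((1 - s : ℝ) : EReal)
      ≤ E.zetaHB r :=
  le_iSup_of_le ρ (le_iSup_of_le σ (le_iSup₂_of_le s hs le_rfl))

theorem POVM.zetaHB_mix_le {p : ℝ} (hp : p ∈ Set.Icc (0 : ℝ) 1) (E : POVM d m) (G : POVM d n)
    (r : ℝ) :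
    (POVM.mix p hp E G).zetaHB r
      ≤ (p : EReal) * E.zetaHB r + ((1 - p : ℝ) : EReal) * G.zetaHB r := by
  refine iSup₂_le fun ρ σ => iSup₂_le fun s hs => ?_
  refine le_trans ?_ (ereal_convex_add_mono hp (E.le_zetaHB r ρ σ hs) (G.le_zetaHB r ρ σ hs))
  simp only [phi]
  rw [POVM.overlap_mix]
  exact affine_elog_convex (sub_pos.2 hs.2) hp (E.overlap_nonneg ρ σ s) (G.overlap_nonneg ρ σ s)

end Discrimination

theorem mainTheorem4 (d m n : ℕ) (hd : 1 ≤ d)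
    (E : Discrimination.POVM d m) (G : Discrimination.POVM d n)
    (p : ℝ) (hp : p ∈ Set.Icc (0 : ℝ) 1) :
    (Discrimination.POVM.mix p hp E G).zetaCB
        ≤ (p : EReal) * E.zetaCB + ((1 - p : ℝ) : EReal) * G.zetaCB ∧
    -Discrimination.elog (min (p * E.C + (1 - p)) (p + (1 - p) * G.C))
        ≤ (Discrimination.POVM.mix p hp E G).zetaCB ∧
    (Discrimination.POVM.mix p hp E G).zetaSL
        ≤ (p : EReal) * E.zetaSL + ((1 - p : ℝ) : EReal) * G.zetaSL ∧
    max ((p : EReal) * E.zetaSL) (((1 - p : ℝ) : EReal) * G.zetaSL)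
        ≤ (Discrimination.POVM.mix p hp E G).zetaSL ∧
    (∀ r : ℝ, 0 ≤ r →
      (Discrimination.POVM.mix p hp E G).zetaHB r
        ≤ (p : EReal) * E.zetaHB r + ((1 - p : ℝ) : EReal) * G.zetaHB r) ∧
    (Discrimination.POVM.mix p hp E G).zetaCB ≤ max E.zetaCB G.zetaCB ∧
    (Discrimination.POVM.mix p hp E G).zetaSL ≤ max E.zetaSL G.zetaSL ∧
    (∀ r : ℝ, 0 ≤ r →
      (Discrimination.POVM.mix p hp E G).zetaHB r ≤ max (E.zetaHB r) (G.zetaHB r)) :=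

  ⟨E.zetaCB_mix_le hp G, E.neg_elog_min_le_zetaCB_mix hd hp G, E.zetaSL_mix_le hp G,
    E.max_le_zetaSL_mix hd hp G, fun r _ => E.zetaHB_mix_le hp G r,
    (E.zetaCB_mix_le hp G).trans (Discrimination.ereal_convex_add_le_max hp _ _),
    (E.zetaSL_mix_le hp G).trans (Discrimination.ereal_convex_add_le_max hp _ _),
    fun r _ => (E.zetaHB_mix_le hp G r).trans (Discrimination.ereal_convex_add_le_max hp _ _)⟩
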